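/- For natural numbers $m,n$, let $HD(m,n)$ be the Hopi rectangle graph of order $(m,n)$: the subgraph of the grid $P_{m+n}\,\square\,P_{m+n}$ (with coordinates $0,\dots,m+n-1$) induced by the vertices $(i,j)$ with $m-1\le i+j\le 2n+m-1$ and $|i-j|\le m$. In a graph whose vertices are coloured blue or white, a blue vertex with exactly one white neighbour may force that neighbour to become blue. A set $B$ of initially blue vertices is a zero forcing set if repeated forces turn the whole graph blue. It is an $\ell$-leaky forcing set if, for every choice of at most $\ell$ vertices (leaks) that are not allowed to perform forces, repeated forces still turn the whole graph blue. Let $Z(G)$ and $Z_{(\ell)}(G)$ denote the minimum sizes of a zero forcing set and of an $\ell$-leaky forcing set of $G$. For all natural numbers $m,n$, the set $$B=\{(i,j): i+j=m-1\}\cup\{(i,j): j=i+m\}\subseteq V(HD(m,n))$$ is a $1$-leaky forcing set of $HD(m,n)$ with $|B|=m+n$, so that $Z_{(1)}(HD(m,n))\le m+n$. Moreover, $$Z(HD(m,n))=Z_{(1)}(HD(m,n))=m+n.$$ -/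

import Mathlib

namespace HopiForcing

section Forcing

variable {V : Type*}

/-- One application of the colour change rule in `G` with set of leaks `L`: a blue vertex `u` that
is not a leak and has exactly one white neighbour `v` forces `v`, and the set of blue vertices
grows from `S` to `insert v S`. For `L = ∅` this is the ordinary zero forcing rule. -/
def ForceStep (G : SimpleGraph V) (L S T : Set V) : Prop :=
  ∃ u v : V, u ∈ S ∧ u ∉ L ∧ G.neighborSet u \ S = {v} ∧ T = insert v S

/-- Starting from the blue set `B`, finitely many forces (with leaks `L`) turn all of `G` blue. -/
def ForcesAll (G : SimpleGraph V) (L B : Set V) : Prop :=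
  Relation.ReflTransGen (ForceStep G L) B Set.univ

/-- `B` is a zero forcing set of `G`. -/
def IsZeroForcingSet (G : SimpleGraph V) (B : Set V) : Prop :=
  ForcesAll G ∅ B

/-- `B` is an `ℓ`-leaky forcing set of `G`: it forces all of `G` for every placement of at most
`ℓ` leaks. The leaks are chosen after `B`, and may lie anywhere in `G`. -/
def IsLeakyForcingSet (G : SimpleGraph V) (ℓ : ℕ) (B : Set V) : Prop :=
  ∀ L : Set V, L.encard ≤ (ℓ : ℕ∞) → ForcesAll G L B

/-- The zero forcing number `Z(G)`: the minimum size of a zero forcing set. (For a finite graph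
the whole vertex set is one, so that the minimum exists.) -/
noncomputable def zeroForcingNumber (G : SimpleGraph V) : ℕ :=
  sInf {k : ℕ | ∃ B : Finset V, IsZeroForcingSet G (B : Set V) ∧ B.card = k}

/-- The `ℓ`-leaky forcing number `Z_(ℓ)(G)`: the minimum size of an `ℓ`-leaky forcing set. (For a
finite graph the whole vertex set is one, so that the minimum exists.) -/
noncomputable def leakyForcingNumber (ℓ : ℕ) (G : SimpleGraph V) : ℕ :=
  sInf {k : ℕ | ∃ B : Finset V, IsLeakyForcingSet G ℓ (B : Set V) ∧ B.card = k}

end Forcing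

/-- The vertices of `HD(m,n)`, as a subset of the vertices of the grid `P_{m+n} □ P_{m+n}`, whose
coordinates run over `0, …, m + n - 1`. The inequalities are between integers. -/
def hopiVertices (m n : ℕ) : Set (Fin (m + n) × Fin (m + n)) :=
  {p | (m : ℤ) - 1 ≤ (p.1.val : ℤ) + (p.2.val : ℤ) ∧
    (p.1.val : ℤ) + (p.2.val : ℤ) ≤ 2 * (n : ℤ) + (m : ℤ) - 1 ∧
    |(p.1.val : ℤ) - (p.2.val : ℤ)| ≤ (m : ℤ)}

/-- The Hopi rectangle graph `HD(m,n)`: the subgraph of `P_{m+n} □ P_{m+n}` induced by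
`hopiVertices m n`. -/
def hopiGraph (m n : ℕ) : SimpleGraph (hopiVertices m n) :=
  ((SimpleGraph.pathGraph (m + n)).boxProd (SimpleGraph.pathGraph (m + n))).induce
    (hopiVertices m n)

/-- The vertices `(i,j)` of `HD(m,n)` with `i + j = m - 1` or `j = i + m`. -/
def hopiB (m n : ℕ) : Set (hopiVertices m n) :=
  {p | (p.1.1.val : ℤ) + (p.1.2.val : ℤ) = (m : ℤ) - 1} ∪
    {p | (p.1.2.val : ℤ) = (p.1.1.val : ℤ) + (m : ℤ)}

end HopiForcing

/-!
In the rotated coordinates `s = i + j - m + 1` and `d = j - i + m`, the graph `HD(m,n)` has as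
vertices the pairs `(s, d)` with `0 ≤ s ≤ 2n`, `0 ≤ d ≤ 2m` and `s + d` odd, two of them being
adjacent when both coordinates differ by exactly one. The bounds on `i` and `j` themselves then hold
automatically. The set `hopiB m n` is the union of the sides `s = 0` and `d = 2m`.

*Lower bound.* The `m` sets `{d = 2k + 1}` and the `n` sets `{s = 2t + 1}` partition the vertices, and
each is a fort: no vertex has exactly one neighbour in it, because reflecting a neighbour `v` of `u`
in the line through `u` parallel to one of the axes gives another neighbour of `u` in the same set.
Since a zero forcing set meets every fort, it has at least `m + n` elements
(`card_le_of_fiber_fort`, `hopiIndex_fort`).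

*Upper bound.* Let the blue set be stalled, with at most one leak `(a, b)`. If `a` is odd, the rows
`s = 0, 1, 2, …` are seen to be blue one after the other: the vertices of row `s` force those of
row `s + 1` from the side `d = 2m` downwards, and when `s` is odd also from `d = 0` upwards, so that
in row `a` the leak can be bypassed by using both directions (`rotated_propagation`). If `a` is even
then `b` is odd, and the reflection exchanging the two sides of `hopiB m n` reduces to the first case.
-/

namespace HopiForcing

/-! ### Forcing in general graphs -/

section General

variable {V : Type*} {G : SimpleGraph V}

/-- To prove that `B` forces everything, it is enough to show that a blue set containing `B` in which
no force is possible contains all vertices. -/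
lemma forcesAll_of_stalled [Finite V] {L B : Set V}
    (h : ∀ S : Set V, B ⊆ S →
      (∀ u v, u ∈ S → u ∉ L → G.Adj u v → (∀ w, G.Adj u w → w ≠ v → w ∈ S) → v ∈ S) →
      ∀ v, v ∈ S) :
    ForcesAll G L B := by
  obtain ⟨S, hBS, hS⟩ :=
    (Set.toFinite {S | Relation.ReflTransGen (ForceStep G L) B S}).exists_le_maximal
      (a := B) Relation.ReflTransGen.refl
  have hall : S = Set.univ := Set.eq_univ_of_forall <| h S hBS fun u v hu hL huv hw => by
    by_contra hv
    have hstep : ForceStep G L S (insert v S) := by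
      refine ⟨u, v, hu, hL, ?_, rfl⟩
      ext w
      simp only [Set.mem_sdiff, SimpleGraph.mem_neighborSet, Set.mem_singleton_iff]
      constructor
      · rintro ⟨h1, h2⟩
        by_contra hne
        exact h2 (hw w h1 hne)
      · rintro rfl
        exact ⟨huv, hv⟩
    exact hv (hS.2 (hS.1.tail hstep) (Set.subset_insert v S) (Set.mem_insert v S))
  have := hS.1
  rwa [hall] at this

/-- If no vertex has exactly one neighbour in the nonempty set `F` (that is, `F` is a fort), then
every zero forcing set meets `F`. -/
lemma IsZeroForcingSet.exists_mem_fort {B F : Set V} (hB : IsZeroForcingSet G B) (hF : F.Nonempty)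
    (hfort : ∀ u v, G.Adj u v → v ∈ F → ∃ w, G.Adj u w ∧ w ∈ F ∧ w ≠ v) :
    ∃ v ∈ B, v ∈ F := by
  by_contra! hcon
  have key : ∀ S, Relation.ReflTransGen (ForceStep G ∅) B S → ∀ v ∈ S, v ∉ F := by
    intro S hS
    induction hS with
    | refl => exact hcon
    | tail _ hstep ih =>
      obtain ⟨u, v, -, -, hN, rfl⟩ := hstep
      rintro w (rfl | hw)
      · intro hwF
        have hadj : w ∈ G.neighborSet u \ _ := hN ▸ Set.mem_singleton w
        obtain ⟨x, hx, hxF, hne⟩ := hfort u w hadj.1 hwF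
        refine hne (?_ : x ∈ ({w} : Set V))
        rw [← hN]
        exact ⟨hx, fun hxS => ih x hxS hxF⟩
      · exact ih w hw
  obtain ⟨v, hv⟩ := hF
  exact key _ hB v (Set.mem_univ v) hv

/-- If the vertices are partitioned into `k` forts, then a zero forcing set has at least `k`
elements. -/
lemma card_le_of_fiber_fort {k : ℕ} (c : V → Fin k) (hc : Function.Surjective c)
    (hfort : ∀ u v, G.Adj u v → ∃ w, G.Adj u w ∧ c w = c v ∧ w ≠ v)
    (B : Finset V) (hB : IsZeroForcingSet G (B : Set V)) : k ≤ B.card := by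
  have : ∀ x : Fin k, ∃ v ∈ (B : Set V), v ∈ {v | c v = x} := fun x =>
    hB.exists_mem_fort (hc x) fun u v huv hv => by
      obtain ⟨w, h1, h2, h3⟩ := hfort u v huv
      exact ⟨w, h1, h2.trans hv, h3⟩
  have hsurj : Set.SurjOn c (B : Set V) ((Finset.univ : Finset (Fin k)) : Set (Fin k)) :=
    fun x _ => this x
  simpa using Finset.card_le_card_of_surjOn c hsurj

lemma IsLeakyForcingSet.isZeroForcingSet {ℓ : ℕ} {B : Set V} (h : IsLeakyForcingSet G ℓ B) :
    IsZeroForcingSet G B :=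
  h ∅ (by simp)

end General

/-! ### Propagation in rotated coordinates -/

/-- Here `P s d` says that `(s, d)` is blue or not a vertex. The blue set contains the sides `s = 0`
and `d = 2m` and is stalled, with no leak other than `(a, b)`, where `a` is odd. The forces that the
argument needs all go from a row `s` whose neighbours in row `s - 1` are already blue. -/
lemma rotated_propagation (m n a b : ℤ) (ha : a % 2 = 1) (P : ℤ → ℤ → Prop)
    (hout : ∀ s d, ¬ (0 ≤ s ∧ s ≤ 2 * n ∧ 0 ≤ d ∧ d ≤ 2 * m ∧ (s + d) % 2 = 1) → P s d)
    (hleft : ∀ d, P 0 d) (htop : ∀ s, P s (2 * m))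
    (hforce : ∀ s d e, 0 ≤ s → s ≤ 2 * n → 0 ≤ d → d ≤ 2 * m → (s + d) % 2 = 1 →
      ¬ (s = a ∧ d = b) → (e = 1 ∨ e = -1) → P s d →
      P (s - 1) (d + 1) → P (s - 1) (d - 1) → P (s + 1) (d - e) → P (s + 1) (d + e)) :
    ∀ s d, P s d := by
  have step : ∀ s, 0 ≤ s → (∀ d, P (s - 1) d) → (∀ d, P s d) → ∀ d, P (s + 1) d := by
    intro s hs hprev hcur
    have down : ∀ (k : ℕ) (d : ℤ), d = 2 * m + 1 - k → (s = a → b ≤ d) → P (s + 1) d := by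
      intro k
      induction k using Nat.strong_induction_on with
      | _ k ih =>
        intro d hd hb
        by_cases hV : 0 ≤ s + 1 ∧ s + 1 ≤ 2 * n ∧ 0 ≤ d ∧ d ≤ 2 * m ∧ (s + 1 + d) % 2 = 1
        · by_cases htop' : d = 2 * m
          · exact htop' ▸ htop _
          · have h2 : P (s + 1) (d + 1 - (-1)) := by
              by_cases hk : 2 ≤ k
              · exact ih (k - 2) (by omega) _ (by omega) (by omega)
              · exact hout _ _ (by omega)
            have := hforce s (d + 1) (-1) hs (by omega) (by omega) (by omega) (by omega)
              (by omega) (Or.inr rfl) (hcur _) (hprev _) (hprev _) h2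
            simpa using this
        · exact hout _ _ hV
    have up : s % 2 = 1 → ∀ (k : ℕ) (d : ℤ), d = k - 1 → (s = a → d ≤ b) → P (s + 1) d := by
      intro hodd k
      induction k using Nat.strong_induction_on with
      | _ k ih =>
        intro d hd hb
        by_cases hV : 0 ≤ s + 1 ∧ s + 1 ≤ 2 * n ∧ 0 ≤ d ∧ d ≤ 2 * m ∧ (s + 1 + d) % 2 = 1
        · have h2 : P (s + 1) (d - 1 - 1) := by
            by_cases hk : 2 ≤ k
            · exact ih (k - 2) (by omega) _ (by omega) (by omega)
            · exact hout _ _ (by omega)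
          have := hforce s (d - 1) 1 hs (by omega) (by omega) (by omega) (by omega)
            (by omega) (Or.inl rfl) (hcur _) (hprev _) (hprev _) h2
          simpa using this
        · exact hout _ _ hV
    intro d
    by_cases hV : 0 ≤ d ∧ d ≤ 2 * m
    · by_cases hb : s = a → b ≤ d
      · exact down (2 * m + 1 - d).toNat d (by omega) hb
      · exact up (by omega) (d + 1).toNat d (by omega) (by omega)
    · exact hout _ _ (by omega)
  have rows : ∀ k : ℕ, (∀ d, P ((k : ℤ) - 1) d) ∧ ∀ d, P (k : ℤ) d := by
    intro k
    induction k with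
    | zero => exact ⟨fun d => hout _ _ (by simp), by simpa using hleft⟩
    | succ k ih =>
      refine ⟨by simpa using ih.2, ?_⟩
      simpa using step k (by omega) ih.1 ih.2
  intro s d
  by_cases hs : 0 ≤ s
  · have := (rows s.toNat).2 d
    rwa [Int.toNat_of_nonneg hs] at this
  · exact hout _ _ (by omega)

/-! ### The Hopi rectangle graph -/

section Hopi

variable {m n : ℕ}

/-- The vertex with rotated coordinates `(s, d)`. -/
lemma exists_vertex (s d : ℤ) (hs : 0 ≤ s) (hs' : s ≤ 2 * n) (hd : 0 ≤ d) (hd' : d ≤ 2 * m)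
    (hp : (s + d) % 2 = 1) :
    ∃ v : hopiVertices m n, (v.1.1.val : ℤ) + v.1.2.val - m + 1 = s ∧
      (v.1.2.val : ℤ) - v.1.1.val + m = d := by
  refine ⟨⟨(⟨((s - d + 2 * m - 1) / 2).toNat, by omega⟩, ⟨((s + d - 1) / 2).toNat, by omega⟩), ?_⟩,
    ?_, ?_⟩
  · simp only [hopiVertices, Set.mem_ofPred_eq, abs_le]
    omega
  · simp only
    omega
  · simp only
    omega

lemma vertex_bounds (v : hopiVertices m n) :
    0 ≤ (v.1.1.val : ℤ) + v.1.2.val - m + 1 ∧ (v.1.1.val : ℤ) + v.1.2.val - m + 1 ≤ 2 * n ∧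
    0 ≤ (v.1.2.val : ℤ) - v.1.1.val + m ∧ (v.1.2.val : ℤ) - v.1.1.val + m ≤ 2 * m := by
  have h := v.2
  simp only [hopiVertices, Set.mem_ofPred_eq, abs_le] at h
  omega

lemma vertex_ext {v w : hopiVertices m n} (h1 : v.1.1.val = w.1.1.val)
    (h2 : v.1.2.val = w.1.2.val) : v = w :=
  Subtype.ext (Prod.ext (Fin.ext h1) (Fin.ext h2))

/-- Adjacency means that both rotated coordinates differ by exactly one. -/
lemma hopiGraph_adj {u v : hopiVertices m n} :
    (hopiGraph m n).Adj u v ↔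
      ((v.1.1.val : ℤ) + v.1.2.val = u.1.1.val + u.1.2.val + 1 ∨
        (v.1.1.val : ℤ) + v.1.2.val = u.1.1.val + u.1.2.val - 1) ∧
      ((v.1.2.val : ℤ) - v.1.1.val = u.1.2.val - u.1.1.val + 1 ∨
        (v.1.2.val : ℤ) - v.1.1.val = u.1.2.val - u.1.1.val - 1) := by
  simp only [hopiGraph, SimpleGraph.comap_adj, Function.Embedding.subtype_apply,
    SimpleGraph.boxProd_adj, SimpleGraph.pathGraph_adj, Fin.ext_iff]
  omega

/-- The index of the fort containing a vertex: the forts `{d = 2k + 1}` come first, then the forts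
`{s = 2t + 1}`. -/
def hopiIndex (m n : ℕ) (v : hopiVertices m n) : Fin (m + n) :=
  ⟨if ((v.1.1.val : ℤ) + v.1.2.val - m + 1) % 2 = 0
    then (((v.1.2.val : ℤ) - v.1.1.val + m) / 2).toNat
    else m + (((v.1.1.val : ℤ) + v.1.2.val - m + 1) / 2).toNat, by
    have := vertex_bounds v
    split_ifs <;> omega⟩

lemma hopiIndex_surjective : Function.Surjective (hopiIndex m n) := by
  rintro ⟨k, hk⟩
  by_cases hkm : k < m
  · obtain ⟨v, h1, h2⟩ := exists_vertex (m := m) (n := n) 0 (2 * k + 1) (by omega) (by omega)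
      (by omega) (by omega) (by omega)
    refine ⟨v, Fin.ext ?_⟩
    simp only [hopiIndex, h1, h2]
    split_ifs <;> omega
  · obtain ⟨v, h1, h2⟩ := exists_vertex (m := m) (n := n) (2 * (k - m) + 1) (2 * m) (by omega)
      (by omega) (by omega) (by omega) (by omega)
    refine ⟨v, Fin.ext ?_⟩
    simp only [hopiIndex, h1, h2]
    split_ifs <;> omega

lemma hopiIndex_injOn : Set.InjOn (hopiIndex m n) (hopiB m n) := by
  intro v hv w hw h
  have hv' := vertex_bounds v
  have hw' := vertex_bounds w
  simp only [hopiB, Set.mem_union, Set.mem_ofPred_eq] at hv hw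
  simp only [hopiIndex, Fin.mk.injEq] at h
  apply vertex_ext <;> (split_ifs at h <;> omega)

/-- The fibres of `hopiIndex` are forts. -/
lemma hopiIndex_fort (u v : hopiVertices m n) (huv : (hopiGraph m n).Adj u v) :
    ∃ w, (hopiGraph m n).Adj u w ∧ hopiIndex m n w = hopiIndex m n v ∧ w ≠ v := by
  rw [hopiGraph_adj] at huv
  have hu := vertex_bounds u
  have hv := vertex_bounds v
  by_cases hpar : ((v.1.1.val : ℤ) + v.1.2.val - m + 1) % 2 = 0
  -- The first coordinate of `u` is odd, so both `s - 1` and `s + 1` are in range: reflect in it.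
  · obtain ⟨w, h1, h2⟩ := exists_vertex (m := m) (n := n)
      (2 * ((u.1.1.val : ℤ) + u.1.2.val - m + 1) - ((v.1.1.val : ℤ) + v.1.2.val - m + 1))
      ((v.1.2.val : ℤ) - v.1.1.val + m) (by omega) (by omega) (by omega) (by omega) (by omega)
    refine ⟨w, hopiGraph_adj.2 (by omega), Fin.ext ?_, ?_⟩
    · simp only [hopiIndex, h1, h2]
      split_ifs <;> omega
    · rintro rfl
      omega
  · obtain ⟨w, h1, h2⟩ := exists_vertex (m := m) (n := n)
      ((v.1.1.val : ℤ) + v.1.2.val - m + 1)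
      (2 * ((u.1.2.val : ℤ) - u.1.1.val + m) - ((v.1.2.val : ℤ) - v.1.1.val + m))
      (by omega) (by omega) (by omega) (by omega) (by omega)
    refine ⟨w, hopiGraph_adj.2 (by omega), Fin.ext ?_, ?_⟩
    · simp only [hopiIndex, h1, h2]
      split_ifs; omega
    · rintro rfl
      omega

/-- A stalled blue set containing `hopiB m n` is everything, if its only possible leak is the point
with rotated coordinates `(a, b)`, one of which is odd. -/
lemma mem_of_stalled {S L : Set (hopiVertices m n)} (a b : ℤ) (hab : a % 2 = 1 ∨ b % 2 = 1)
    (hL : ∀ u ∈ L, (u.1.1.val : ℤ) + u.1.2.val - m + 1 = a ∧ (u.1.2.val : ℤ) - u.1.1.val + m = b)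
    (hB : hopiB m n ⊆ S)
    (hS : ∀ u v, u ∈ S → u ∉ L → (hopiGraph m n).Adj u v →
      (∀ w, (hopiGraph m n).Adj u w → w ≠ v → w ∈ S) → v ∈ S) :
    ∀ v, v ∈ S := by
  let P : ℤ → ℤ → Prop := fun s d => ∀ v : hopiVertices m n,
    (v.1.1.val : ℤ) + v.1.2.val - m + 1 = s → (v.1.2.val : ℤ) - v.1.1.val + m = d → v ∈ S
  have hout : ∀ s d, ¬ (0 ≤ s ∧ s ≤ 2 * (n : ℤ) ∧ 0 ≤ d ∧ d ≤ 2 * (m : ℤ) ∧ (s + d) % 2 = 1) →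
      P s d := by
    intro s d h v h1 h2
    have := vertex_bounds v
    omega
  have hleft : ∀ d, P 0 d := fun d v h1 _ => hB (Or.inl (by
    simp only [Set.mem_ofPred_eq]
    omega))
  have htop : ∀ s, P s (2 * m) := fun s v _ h2 => hB (Or.inr (by
    simp only [Set.mem_ofPred_eq]
    omega))
  -- If three of the four diagonal neighbours of a blue non-leak are blue or missing, so is the last.
  have hforce : ∀ s d e f, 0 ≤ s → s ≤ 2 * (n : ℤ) → 0 ≤ d → d ≤ 2 * (m : ℤ) → (s + d) % 2 = 1 →
      ¬ (s = a ∧ d = b) → (e = 1 ∨ e = -1) → (f = 1 ∨ f = -1) → P s d →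
      P (s - e) (d + f) → P (s - e) (d - f) → P (s + e) (d - f) → P (s + e) (d + f) := by
    intro s d e f hs hs' hd hd' hp hleak he hf h0 h1 h2 h3 v hv1 hv2
    obtain ⟨u, hu1, hu2⟩ := exists_vertex (m := m) (n := n) s d hs hs' hd hd' hp
    refine hS u v (h0 u hu1 hu2) (fun hu => hleak ?_) (hopiGraph_adj.2 (by omega)) ?_
    · have := hL u hu
      omega
    · intro w hw hne
      rw [hopiGraph_adj] at hw
      by_cases hws : (w.1.1.val : ℤ) + w.1.2.val - m + 1 = s + e
      · refine h3 w hws ?_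
        by_contra hwd
        exact hne (vertex_ext (by omega) (by omega))
      · by_cases hwd : (w.1.2.val : ℤ) - w.1.1.val + m = d + f
        · exact h1 w (by omega) hwd
        · exact h2 w (by omega) (by omega)
  have hP : ∀ s d, P s d := by
    rcases hab with ha | hb
    · refine rotated_propagation m n a b ha P hout hleft htop ?_
      intro s d e hs hs' hd hd' hp hl he h0 h1 h2 h3
      refine hforce s d 1 e hs hs' hd hd' hp hl (Or.inl rfl) he h0 ?_ ?_ h3
      · rcases he with rfl | rfl
        exacts [h1, h2]
      · rcases he with rfl | rfl
        · exact h2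
        · simpa using h1
    -- The reflection `(s, d) ↦ (2m - d, 2n - s)` exchanges the two sides of `hopiB m n`.
    · have := rotated_propagation n m (2 * m - b) (2 * n - a) (by omega)
        (fun x y => P (2 * n - y) (2 * m - x))
        (fun x y h => hout _ _ (by omega)) (fun y => by simpa using htop _)
        (fun x => by simpa using hleft _) ?_
      · intro s d
        simpa using this (2 * m - d) (2 * n - s)
      · intro x y e hx hx' hy hy' hp hl he h0 h1 h2 h3
        have := hforce (2 * n - y) (2 * m - x) (-e) (-1) (by omega) (by omega) (by omega) (by omega)
          (by omega) (by omega) (by omega) (Or.inr rfl) h0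
        have e1 : (2 * (n : ℤ) - y) - -e = 2 * n - (y - e) := by ring
        have e2 : (2 * (n : ℤ) - y) + -e = 2 * n - (y + e) := by ring
        have e3 : (2 * (m : ℤ) - x) - -1 = 2 * m - (x - 1) := by ring
        have e4 : (2 * (m : ℤ) - x) + -1 = 2 * m - (x + 1) := by ring
        rw [e1, e2, e3, e4] at this
        rcases he with rfl | rfl
        · exact this h3 h2 h1
        · rw [sub_neg_eq_add, ← sub_eq_add_neg] at this
          exact this (by simpa using h3) h1 h2
  exact fun v => hP _ _ v rfl rfl

lemma hopiB_isLeakyForcingSet (m n : ℕ) : IsLeakyForcingSet (hopiGraph m n) 1 (hopiB m n) := by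
  intro L hL
  have hL' : L.Subsingleton := Set.encard_le_one_iff_subsingleton.1 (by simpa using hL)
  refine forcesAll_of_stalled fun S hB hS => ?_
  rcases hL'.eq_empty_or_singleton with rfl | ⟨u, rfl⟩
  · exact mem_of_stalled 1 0 (by norm_num) (by simp) hB hS
  · exact mem_of_stalled ((u.1.1.val : ℤ) + u.1.2.val - m + 1) ((u.1.2.val : ℤ) - u.1.1.val + m)
      (by omega) (by rintro _ rfl; exact ⟨rfl, rfl⟩) hB hS

end Hopi

end HopiForcing

open HopiForcing in
theorem mainTheorem2 (m n : ℕ) :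
    HopiForcing.IsLeakyForcingSet (HopiForcing.hopiGraph m n) 1 (HopiForcing.hopiB m n) ∧
    (HopiForcing.hopiB m n).ncard = m + n ∧
    HopiForcing.leakyForcingNumber 1 (HopiForcing.hopiGraph m n) ≤ m + n ∧
    HopiForcing.zeroForcingNumber (HopiForcing.hopiGraph m n) =
      HopiForcing.leakyForcingNumber 1 (HopiForcing.hopiGraph m n) ∧
    HopiForcing.leakyForcingNumber 1 (HopiForcing.hopiGraph m n) = m + n := by
  have hleaky := hopiB_isLeakyForcingSet m n
  have hlow := card_le_of_fiber_fort (hopiIndex m n) hopiIndex_surjective hopiIndex_fort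
  have hfin : (hopiB m n).Finite := Set.toFinite _
  have hcoe : (hfin.toFinset : Set (hopiVertices m n)) = hopiB m n := hfin.coe_toFinset
  have hcard : hfin.toFinset.card = m + n := by
    refine le_antisymm ?_ (hlow _ (by rw [hcoe]; exact hleaky.isZeroForcingSet))
    have := Finset.card_le_card_of_injOn (t := Finset.univ) (hopiIndex m n) (by simp)
      (by rw [hcoe]; exact hopiIndex_injOn)
    simpa using this
  have hl : leakyForcingNumber 1 (hopiGraph m n) = m + n := by
    refine le_antisymm (Nat.sInf_le ⟨_, by rwa [hcoe], hcard⟩)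
      (le_csInf ⟨_, _, by rwa [hcoe], hcard⟩ ?_)
    rintro _ ⟨B, hB, rfl⟩
    exact hlow B hB.isZeroForcingSet
  have hz : zeroForcingNumber (hopiGraph m n) = m + n := by
    refine le_antisymm (Nat.sInf_le ⟨_, by rw [hcoe]; exact hleaky.isZeroForcingSet, hcard⟩)
      (le_csInf ⟨_, _, by rw [hcoe]; exact hleaky.isZeroForcingSet, hcard⟩ ?_)
    rintro _ ⟨B, hB, rfl⟩
    exact hlow B hB
  exact ⟨hleaky, by rw [Set.ncard_eq_toFinset_card _ hfin, hcard], hl.le, hz.trans hl.symm, hl⟩
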